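/- **Theorem (Classification of Covering Maps).** Let $X$ be a path connected and locally path connected space that is semi-locally simply connected: every neighborhood of every point $x\in X$ contains a neighborhood $U$ of $x$ such that every loop at $x$ in $U$ is null-homotopic in $X$ (relative to its base point). Let $\pi(X)$ be the fundamental groupoid of $X$; its objects are the points of $X$ and its morphisms $x_0\to x_1$ are the path homotopy classes of paths from $x_0$ to $x_1$, composed by concatenation. Let $\mathrm{Cov}(X)$ be the category whose objects are the covering maps $p\colon Y\to X$ (each point of $X$ has an open neighborhood $U$ with $p^{-1}(U)\cong U\times D$ over $U$ for some discrete space $D$, where $D=\emptyset$ is allowed) and whose morphisms are the continuous maps over $X$. * The monodromy functor of a covering map $p\colon Y\to X$ is the functor $F(p)\colon\pi(X)\to\mathbf{Set}$ with $F(p)(x)=p^{-1}(x)$, in which the class of a path $u$ from $x_0$ to $x_1$ sends $y\in p^{-1}(x_0)$ to $y\cdot[u]$, the end point of the lift of $u$ starting at $y$. A morphism of covering maps is sent to the natural transformation given by its restrictions to the fibres. * For a functor $F\colon\pi(X)\to\mathbf{Set}$ let $Y(F)=\coprod_{x\in X}F(x)$, let $p(F)\colon Y(F)\to X$ send $F(x)$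 to $x$, and give $Y(F)$ the topology generated by the sets $(U,y)=\{F([u])(y) \mid u \text{ a path in } U \text{ starting at } x\}$, where $x\in X$, $y\in F(x)$, and $U$ is an open path connected neighborhood of $x$ such that every loop at $x$ in $U$ is null-homotopic in $X$. A natural transformation $F\Rightarrow G$ is sent to the induced map $Y(F)\to Y(G)$. Then: 1. For every functor $F\colon\pi(X)\to\mathbf{Set}$ the map $p(F)\colon Y(F)\to X$ is a covering map, and the functors $$\mathrm{Cov}(X)\rightleftarrows\mathrm{Func}(\pi(X),\mathbf{Set}),\qquad p\mapsto F(p),\qquad F\mapsto (p(F)\colon Y(F)\to X)$$ are equivalences of categories, inverse to each other up to canonical natural isomorphism: the bijections $Y\to Y(F(p))=\coprod_{x} p^{-1}(x)$, $y\mapsto (p(y),y)$, are isomorphisms of covering spaces, natural in $p$, and the bijections $F(p(F))(x)=\{x\}\times F(x)\to F(x)$, $(x,a)\mapsto a$, form an isomorphism of functors, natural in $F$. 2. A covering map $p$ is surjective if and only if all the sets $F(p)(x)$ are non-empty, and $p(F)$ is surjective if and only if all the sets $F(x)$ are non-empty; so surjective covering maps correspond to functors with non-empty values. 3. For every $x_0\in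 X$ the functor $(p\colon Y\to X)\mapsto p^{-1}(x_0)$, with the right action $(y,[u])\mapsto y\cdot[u]$ of $\pi_1(X,x_0)$ (where $[u]\cdot[v]$ is the class of $u$ followed by $v$), is an equivalence from $\mathrm{Cov}(X)$ to the category of right $\pi_1(X,x_0)$-sets and equivariant maps. A covering map $p$ is surjective if and only if $p^{-1}(x_0)$ is non-empty. -/

import Mathlib

open CategoryTheory

universe u

/-- Every neighborhood of every point `x` contains a neighborhood `U` of `x` such that every loop
at `x` in `U` is contractible in `X`. -/
def SemilocallySimplyConnected (X : Type u) [TopologicalSpace X] : Prop :=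
  ∀ x : X, ∀ N ∈ nhds x, ∃ U ∈ nhds x, U ⊆ N ∧
    ∀ γ : Path x x, (∀ t, γ t ∈ U) → γ.Homotopic (Path.refl x)

/-- A covering space of `X`. The fibres are allowed to be empty (so over a path connected `X` the
only difference with surjective covering maps is the empty covering). -/
structure Cov (X : Type u) [TopologicalSpace X] where
  total : Type u
  [top : TopologicalSpace total]
  proj : total → X
  isCov : IsCoveringMap proj

namespace Cov

variable {X : Type u} [TopologicalSpace X]

instance (C : Cov X) : TopologicalSpace C.total := C.top

/-- A morphism of covering spaces: a continuous map over `X`. -/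
structure Hom (C D : Cov X) where
  toFun : C.total → D.total
  continuous_toFun : Continuous toFun
  proj_toFun : ∀ y, D.proj (toFun y) = C.proj y

instance : Category (Cov X) where
  Hom := Hom
  id C := ⟨id, continuous_id, fun _ => rfl⟩
  comp f g := ⟨g.toFun ∘ f.toFun, g.continuous_toFun.comp f.continuous_toFun,
    fun y => (g.proj_toFun _).trans (f.proj_toFun y)⟩

/-- A morphism of covering spaces commutes with sliding fibres along paths. -/
theorem monodromy_hom {C D : Cov X} (f : C ⟶ D) {x x' : X} (γ : Path.Homotopic.Quotient x x')
    (e : C.proj ⁻¹' {x}) :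
    D.isCov.monodromy γ ⟨f.toFun e.1, (f.proj_toFun e.1).trans e.2⟩ =
      ⟨f.toFun (C.isCov.monodromy γ e).1,
        (f.proj_toFun _).trans (C.isCov.monodromy γ e).2⟩ := by
  obtain ⟨γ⟩ := γ
  have h0 : γ.toContinuousMap 0 = C.proj e.1 := γ.source.trans e.2.symm
  have h0' : γ.toContinuousMap 0 = D.proj (f.toFun e.1) := h0.trans (f.proj_toFun _).symm
  have key : f.toFun ∘ (C.isCov.liftPath γ.toContinuousMap e.1 h0)
      = D.isCov.liftPath γ.toContinuousMap (f.toFun e.1) h0' := by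
    refine (D.isCov.eq_liftPath_iff h0').2 ⟨f.continuous_toFun.comp (map_continuous _), ?_, ?_⟩
    · rw [← Function.comp_assoc, show D.proj ∘ f.toFun = C.proj from funext f.proj_toFun]
      exact C.isCov.liftPath_lifts _ _ h0
    · exact congrArg f.toFun (C.isCov.liftPath_zero _ _ h0)
  exact Subtype.ext (congrFun key 1).symm

/-- The functor `Cov(X) → Func(π(X), Set)` taking a covering map `p` to its monodromy functor
`x ↦ p⁻¹(x)`, and a map of covering spaces to its restrictions to the fibres. -/
noncomputable def monodromyFunctor (X : Type u) [TopologicalSpace X] :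
    Cov X ⥤ (FundamentalGroupoid X ⥤ Type u) where
  obj C := C.isCov.monodromyFunctor
  map {C D} f :=
    { app := fun x => TypeCat.ofHom
        (fun e : C.proj ⁻¹' {x.as} =>
          (⟨f.toFun e.1, (f.proj_toFun e.1).trans e.2⟩ : D.proj ⁻¹' {x.as}))
      naturality := by
        intro x x' γ
        ext e
        exact (monodromy_hom f γ e).symm }
  map_id _ := rfl
  map_comp _ _ := rfl

end Cov

/-- The disjoint union `Y(F)` of the sets `F(x)`, `x ∈ X`. -/
structure CoverSpace {X : Type u} [TopologicalSpace X] (F : FundamentalGroupoid X ⥤ Type u) where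
  pt : X
  val : F.obj ⟨pt⟩

namespace CoverSpace

variable {X : Type u} [TopologicalSpace X]

/-- `U` is an open path connected neighborhood of `x` such that every loop at `x` in `U` is
nullhomotopic in `X`. -/
structure IsGoodNhd (U : Set X) (x : X) : Prop where
  isOpen : IsOpen U
  mem : x ∈ U
  isPathConnected : IsPathConnected U
  loop_null : ∀ γ : Path x x, (∀ t, γ t ∈ U) → γ.Homotopic (Path.refl x)

/-- The morphism of the fundamental groupoid represented by a path. -/
def pathHom {x z : X} (γ : Path x z) : FundamentalGroupoid.mk x ⟶ FundamentalGroupoid.mk z :=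
  FundamentalGroupoid.fromPath (Path.Homotopic.Quotient.mk γ)

/-- The set `(U, y)` of all `(z, F(u)(y))` where `u` is a path in `U` from `x` to `z`. -/
def sheet (F : FundamentalGroupoid X ⥤ Type u) (U : Set X) {x : X} (y : F.obj ⟨x⟩) :
    Set (CoverSpace F) :=
  {w | ∃ γ : Path x w.pt, (∀ t, γ t ∈ U) ∧ F.map (pathHom γ) y = w.val}

/-- The topology on `Y(F)` generated by the sets `(U, y)`. -/
instance (F : FundamentalGroupoid X ⥤ Type u) : TopologicalSpace (CoverSpace F) :=
  TopologicalSpace.generateFrom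
    {S | ∃ (U : Set X) (x : X) (y : F.obj ⟨x⟩), IsGoodNhd U x ∧ S = sheet F U y}

/-- The map `Y(F) → Y(G)` induced by a natural transformation. -/
def map {F G : FundamentalGroupoid X ⥤ Type u} (τ : F ⟶ G) (w : CoverSpace F) : CoverSpace G :=
  ⟨w.pt, τ.app ⟨w.pt⟩ w.val⟩

theorem continuous_map {F G : FundamentalGroupoid X ⥤ Type u} (τ : F ⟶ G) :
    Continuous (map τ) := by
  refine continuous_generateFrom_iff.2 ?_
  rintro _ ⟨U, x, y, hU, rfl⟩
  have : map τ ⁻¹' sheet G U y = ⋃ (y' : F.obj ⟨x⟩) (_ : τ.app ⟨x⟩ y' = y), sheet F U y' := by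
    ext ⟨z, a⟩
    simp only [Set.mem_preimage, Set.mem_iUnion]
    constructor
    · rintro ⟨(γ : Path x z), hγ, (h : G.map (pathHom γ) y = τ.app ⟨z⟩ a)⟩
      refine ⟨F.map (Groupoid.inv (pathHom γ)) a, ?_, γ, hγ, ?_⟩
      · rw [NatTrans.naturality_apply, ← h, ← Functor.map_comp_apply, Groupoid.comp_inv,
          Functor.map_id_apply]
      · change F.map (pathHom γ) (F.map (Groupoid.inv (pathHom γ)) a) = a
        rw [← Functor.map_comp_apply, Groupoid.inv_comp, Functor.map_id_apply]
    · rintro ⟨y', rfl, (γ : Path x z), hγ, (h : F.map (pathHom γ) y' = a)⟩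
      refine ⟨γ, hγ, ?_⟩
      change G.map (pathHom γ) (τ.app ⟨x⟩ y') = τ.app ⟨z⟩ a
      rw [← h, NatTrans.naturality_apply]
  rw [this]
  exact isOpen_iUnion fun y' => isOpen_iUnion fun _ =>
    TopologicalSpace.isOpen_generateFrom_of_mem ⟨U, x, y', hU, rfl⟩

/-- The functor `F ↦ (Y(F) → X)` from `Func(π(X), Set)` to `Cov(X)`, once all the projections
`Y(F) → X` are known to be covering maps. -/
def functor (h : ∀ F : FundamentalGroupoid X ⥤ Type u, IsCoveringMap (pt : CoverSpace F → X)) :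
    (FundamentalGroupoid X ⥤ Type u) ⥤ Cov X where
  obj F := ⟨CoverSpace F, pt, h F⟩
  map τ := ⟨map τ, continuous_map τ, fun _ => rfl⟩
  map_id _ := rfl
  map_comp _ _ := rfl

end CoverSpace

/-- A set with a right action of `π₁(X, x₀)`, where the product of two homotopy classes of loops
is the class of the first loop followed by the second. -/
structure RightPiOneSet (X : Type u) [TopologicalSpace X] (x₀ : X) where
  carrier : Type u
  act : carrier → Path.Homotopic.Quotient x₀ x₀ → carrier
  act_one : ∀ s, act s (Path.Homotopic.Quotient.refl x₀) = s
  act_mul : ∀ s a b, act s (a.trans b) = act (act s a) b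

namespace RightPiOneSet

variable {X : Type u} [TopologicalSpace X] {x₀ : X}

/-- An equivariant map. -/
structure Hom (S T : RightPiOneSet X x₀) where
  toFun : S.carrier → T.carrier
  map_act : ∀ s a, toFun (S.act s a) = T.act (toFun s) a

instance : Category (RightPiOneSet X x₀) where
  Hom := Hom
  id S := ⟨id, fun _ _ => rfl⟩
  comp f g := ⟨g.toFun ∘ f.toFun, fun s a =>
    (congrArg g.toFun (f.map_act s a)).trans (g.map_act _ a)⟩

end RightPiOneSet

/-- The functor taking a covering map `p` to the fibre `p⁻¹(x₀)` with the right monodromy action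
of `π₁(X, x₀)`, in which `y · [u]` is the end point of the lift of `u` starting at `y`. -/
noncomputable def Cov.fibreFunctor (X : Type u) [TopologicalSpace X] (x₀ : X) :
    Cov X ⥤ RightPiOneSet X x₀ where
  obj C :=
    { carrier := C.proj ⁻¹' {x₀}
      act := fun e a => C.isCov.monodromy a e
      act_one := fun e => congrFun C.isCov.monodromy_refl e
      act_mul := fun e a b => C.isCov.monodromy_trans_apply a b e }
  map f :=
    { toFun := fun e => ⟨f.toFun e.1, (f.proj_toFun e.1).trans e.2⟩
      map_act := fun e a => (Cov.monodromy_hom f a e).symm }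
  map_id _ := rfl
  map_comp _ _ := rfl

/-! In a good neighborhood `U` of `x`, two paths with the same ends are homotopic in `X`, so `F` is
canonically constant over `U`: the sheets `(U, y)`, for `y` in `F(x)`, partition the part of `Y(F)`
over `U`, and each projects bijectively to `U`. Since the projection is continuous and open, it is a
covering map (`isCoveringMap_pt`).

Transporting `y` by `F` along the initial segments of a path lifts this path to `Y(F)`. Hence the
monodromy of `Y(F)` is `F` again (`monodromy_pt`), which gives the counit. Conversely, `y ↦ (p(y),
y)` is a continuous bijection over `X` between spaces that are both locally homeomorphic to `X`,
hence a homeomorphism; this gives the unit.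

Finally, a connected groupoid is equivalent to its vertex group at `x₀`, so evaluation at `x₀` is an
equivalence onto right `π₁(X, x₀)`-sets. -/

namespace CoverSpace

variable {X : Type u} [TopologicalSpace X]

/-- A locally path connected, semilocally simply connected space has arbitrarily small good
neighborhoods. -/
theorem _root_.SemilocallySimplyConnected.exists_isGoodNhd [LocallyPathConnectedSpace X]
    (hX : SemilocallySimplyConnected X) {x : X} {N : Set X} (hN : N ∈ nhds x) :
    ∃ U ⊆ N, IsGoodNhd U x := by
  obtain ⟨V, hV, hVN, hloop⟩ := hX x N hN
  have hx : x ∈ interior V := mem_interior_iff_mem_nhds.2 hV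
  have hsub : pathComponentIn (interior V) x ⊆ V :=
    pathComponentIn_subset.trans interior_subset
  exact ⟨pathComponentIn (interior V) x, hsub.trans hVN, isOpen_interior.pathComponentIn x,
    mem_pathComponentIn_self hx, isPathConnected_pathComponentIn hx,
    fun γ hγ => hloop γ fun t => hsub (hγ t)⟩

theorem pathHom_refl (x : X) : pathHom (Path.refl x) = 𝟙 (FundamentalGroupoid.mk x) := rfl

theorem pathHom_trans {x y z : X} (γ : Path x y) (δ : Path y z) :
    pathHom (γ.trans δ) = pathHom γ ≫ pathHom δ := rfl

theorem pathHom_symm {x y : X} (γ : Path x y) : pathHom γ.symm = Groupoid.inv (pathHom γ) := rfl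

theorem pathHom_eq {x y : X} {γ δ : Path x y} (h : γ.Homotopic δ) : pathHom γ = pathHom δ :=
  Quotient.sound h

theorem trans_mem {U : Set X} {x y z : X} {γ : Path x y} {δ : Path y z} (hγ : ∀ t, γ t ∈ U)
    (hδ : ∀ t, δ t ∈ U) (t : unitInterval) : γ.trans δ t ∈ U := by
  rw [Path.trans_apply]
  split_ifs
  exacts [hγ _, hδ _]

theorem symm_mem {U : Set X} {x y : X} {γ : Path x y} (hγ : ∀ t, γ t ∈ U) (t : unitInterval) :
    γ.symm t ∈ U := hγ _

namespace IsGoodNhd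

variable {U : Set X} {x : X} (hU : IsGoodNhd U x)
include hU

theorem pathHom_loop {γ : Path x x} (hγ : ∀ t, γ t ∈ U) : pathHom γ = 𝟙 _ :=
  pathHom_eq (hU.loop_null γ hγ)

/-- Two paths in a good neighborhood with the same end points are homotopic. -/
theorem pathHom_eq_of_mem {y z : X} {γ δ : Path y z} (hγ : ∀ t, γ t ∈ U) (hδ : ∀ t, δ t ∈ U) :
    pathHom γ = pathHom δ := by
  obtain ⟨α, hα⟩ := hU.isPathConnected.joinedIn x hU.mem y (by simpa using hγ 0)
  -- Only loops at `x` are known to be null-homotopic, so both paths are first prolonged by `α` to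
  -- start at `x`.
  have h := hU.pathHom_loop
    (trans_mem (trans_mem hα hγ) (symm_mem (trans_mem hα hδ)))
  simp only [pathHom_trans, pathHom_symm] at h
  rw [← cancel_epi (pathHom α), ← cancel_mono (Groupoid.inv (pathHom α ≫ pathHom δ)), h,
    Groupoid.comp_inv]

end IsGoodNhd

/-! ### Sheets and the covering map `Y(F) → X` -/

variable {F : FundamentalGroupoid X ⥤ Type u}

theorem map_pathHom_symm_apply {x y : X} (γ : Path x y) (a : F.obj ⟨x⟩) :
    F.map (pathHom γ.symm) (F.map (pathHom γ) a) = a := by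
  rw [← Functor.map_comp_apply, pathHom_symm, Groupoid.comp_inv, Functor.map_id_apply]

theorem map_pathHom_apply_symm {x y : X} (γ : Path x y) (a : F.obj ⟨y⟩) :
    F.map (pathHom γ) (F.map (pathHom γ.symm) a) = a := by
  rw [← Functor.map_comp_apply, pathHom_symm, Groupoid.inv_comp, Functor.map_id_apply]

theorem nonempty_obj [PathConnectedSpace X] {x : X} (a : F.obj ⟨x⟩) (y : X) :
    Nonempty (F.obj ⟨y⟩) :=
  ⟨F.map (pathHom (PathConnectedSpace.somePath x y)) a⟩

theorem pt_mem_of_mem_sheet {U : Set X} {x : X} {y : F.obj ⟨x⟩} {w : CoverSpace F}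
    (hw : w ∈ sheet F U y) : w.pt ∈ U := by
  obtain ⟨γ, hγ, -⟩ := hw
  simpa using hγ 1

/-- Concatenation of paths allows a sheet to be recentred at any of its points. -/
theorem sheet_subset {U V : Set X} {x : X} {y : F.obj ⟨x⟩} {w : CoverSpace F}
    (hw : w ∈ sheet F U y) (hVU : V ⊆ U) : sheet F V w.val ⊆ sheet F U y := by
  obtain ⟨γ, hγ, h⟩ := hw
  rintro v ⟨δ, hδ, h'⟩
  refine ⟨γ.trans δ, trans_mem hγ fun t => hVU (hδ t), ?_⟩
  rw [pathHom_trans, Functor.map_comp_apply, h, h']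

theorem mem_sheet_self {U : Set X} {w : CoverSpace F} (h : w.pt ∈ U) : w ∈ sheet F U w.val :=
  ⟨Path.refl _, fun _ => h, by rw [pathHom_refl, Functor.map_id_apply]⟩

theorem isOpen_sheet {U : Set X} {x : X} (hU : IsGoodNhd U x) (y : F.obj ⟨x⟩) :
    IsOpen (sheet F U y) :=
  TopologicalSpace.isOpen_generateFrom_of_mem ⟨U, x, y, hU, rfl⟩

theorem pt_injOn_sheet {U : Set X} {x : X} (hU : IsGoodNhd U x) (y : F.obj ⟨x⟩) :
    (sheet F U y).InjOn pt := by
  rintro ⟨z, a⟩ ⟨(γ : Path x z), hγ, (h : F.map (pathHom γ) y = a)⟩ ⟨z', b⟩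
    ⟨(δ : Path x z'), hδ, (h' : F.map (pathHom δ) y = b)⟩ (rfl : z = z')
  rw [← h, ← h', hU.pathHom_eq_of_mem hγ hδ]

theorem pt_surjOn_sheet {U : Set X} {x : X} (hU : IsGoodNhd U x) (y : F.obj ⟨x⟩) :
    (sheet F U y).SurjOn pt U := by
  intro z hz
  obtain ⟨γ, hγ⟩ := hU.isPathConnected.joinedIn x hU.mem z hz
  exact ⟨⟨z, F.map (pathHom γ) y⟩, ⟨γ, hγ, rfl⟩, rfl⟩

theorem eq_of_mem_sheet {U : Set X} {x : X} (hU : IsGoodNhd U x) {y y' : F.obj ⟨x⟩}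
    {w : CoverSpace F} (hw : w ∈ sheet F U y) (hw' : w ∈ sheet F U y') : y = y' := by
  obtain ⟨γ, hγ, h⟩ := hw
  obtain ⟨δ, hδ, h'⟩ := hw'
  rw [← map_pathHom_symm_apply γ y, ← map_pathHom_symm_apply γ y', h,
    hU.pathHom_eq_of_mem hγ hδ, h']

theorem exists_mem_sheet {U : Set X} {x : X} (hU : IsGoodNhd U x) {w : CoverSpace F}
    (hw : w.pt ∈ U) : ∃ y : F.obj ⟨x⟩, w ∈ sheet F U y := by
  obtain ⟨γ, hγ⟩ := hU.isPathConnected.joinedIn x hU.mem w.pt hw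
  exact ⟨F.map (pathHom γ.symm) w.val, γ, hγ, map_pathHom_apply_symm γ w.val⟩

/-- The sheets are given only as a subbasis. Allowing every `V ⊆ N` makes the property stable under
finite intersections. -/
theorem exists_sheet_subset {S : Set (CoverSpace F)} (hS : IsOpen S) {w : CoverSpace F}
    (hw : w ∈ S) : ∃ N ∈ nhds w.pt, ∀ V ⊆ N, sheet F V w.val ⊆ S := by
  induction hS with
  | basic S hS =>
    obtain ⟨U, x, y, hU, rfl⟩ := hS
    exact ⟨U, hU.isOpen.mem_nhds (pt_mem_of_mem_sheet hw), fun V hV => sheet_subset hw hV⟩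
  | univ => exact ⟨Set.univ, Filter.univ_mem, fun _ _ => Set.subset_univ _⟩
  | inter S T _ _ ihS ihT =>
    obtain ⟨N, hN, h⟩ := ihS hw.1
    obtain ⟨N', hN', h'⟩ := ihT hw.2
    exact ⟨N ∩ N', Filter.inter_mem hN hN', fun V hV =>
      Set.subset_inter (h V (hV.trans Set.inter_subset_left))
        (h' V (hV.trans Set.inter_subset_right))⟩
  | sUnion s _ ih =>
    obtain ⟨S, hS, hwS⟩ := hw
    obtain ⟨N, hN, h⟩ := ih S hS hwS
    exact ⟨N, hN, fun V hV => (h V hV).trans (Set.subset_sUnion_of_mem hS)⟩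

section

variable [LocallyPathConnectedSpace X] (hX : SemilocallySimplyConnected X)
include hX

theorem continuous_pt : Continuous (pt : CoverSpace F → X) := by
  refine continuous_def.2 fun W hW => isOpen_iff_forall_mem_open.2 fun w hw => ?_
  obtain ⟨U, hUW, hU⟩ := hX.exists_isGoodNhd (hW.mem_nhds hw)
  exact ⟨sheet F U w.val, fun v hv => hUW (pt_mem_of_mem_sheet hv), isOpen_sheet hU _,
    mem_sheet_self hU.mem⟩

theorem isOpenMap_pt : IsOpenMap (pt : CoverSpace F → X) := by
  intro S hS
  refine isOpen_iff_mem_nhds.2 ?_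
  rintro _ ⟨w, hw, rfl⟩
  obtain ⟨N, hN, h⟩ := exists_sheet_subset hS hw
  obtain ⟨U, hUN, hU⟩ := hX.exists_isGoodNhd hN
  exact Filter.mem_of_superset (hU.isOpen.mem_nhds hU.mem)
    ((pt_surjOn_sheet hU w.val).trans (Set.image_mono (h U hUN)))

theorem isCoveringMap_pt [PathConnectedSpace X] (F : FundamentalGroupoid X ⥤ Type u) :
    IsCoveringMap (pt : CoverSpace F → X) := by
  intro x
  obtain ⟨U, -, hU⟩ := hX.exists_isGoodNhd (Filter.univ_mem (f := nhds x))
  let _ : TopologicalSpace (F.obj ⟨x⟩) := ⊥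
  have : DiscreteTopology (F.obj ⟨x⟩) := ⟨rfl⟩
  refine IsEvenlyCovered.to_isEvenlyCovered_preimage (I := F.obj ⟨x⟩) ?_
  -- If `F(x)` is empty, nothing lies over `U`. Otherwise there is some function `X → Y(F)`, as the
  -- trivialization requires.
  rcases isEmpty_or_nonempty (F.obj ⟨x⟩) with hE | ⟨⟨a⟩⟩
  · refine .of_preimage_eq_empty _ (hU.isOpen.mem_nhds hU.mem) ?_
    refine Set.eq_empty_of_forall_notMem fun w hw => ?_
    exact hE.elim (exists_mem_sheet hU hw).choose
  · have : Nonempty (F.obj ⟨x⟩) := ⟨a⟩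
    have : Nonempty (X → CoverSpace F) := ⟨fun z => ⟨z, (nonempty_obj a z).some⟩⟩
    refine .of_trivialization (t := hU.isOpen.trivializationDiscrete (fun y => sheet F U y) U
      (fun y W hW => ⟨fun h => (h.preimage (continuous_pt hX)).inter (isOpen_sheet hU y),
        fun h => ?_⟩) (pt_injOn_sheet hU) (pt_surjOn_sheet hU)
      (fun y y' hne => Set.disjoint_left.2 fun w hw hw' => hne (eq_of_mem_sheet hU hw hw'))
      fun w hw => Set.mem_iUnion.2 (exists_mem_sheet hU hw)) hU.mem
    -- A subset `W` of `U` is the image of its preimage in the sheet.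
    convert isOpenMap_pt hX _ h
    refine Set.Subset.antisymm (fun z hz => ?_) ?_
    · obtain ⟨w, hw, rfl⟩ := pt_surjOn_sheet hU y (hW hz)
      exact ⟨w, ⟨hz, hw⟩, rfl⟩
    · rintro _ ⟨w, hw, rfl⟩
      exact hw.1

end

/-! ### Lifting paths to `Y(F)` -/

/-- The lift of a path to `Y(F)` starting at `(a, y)`. -/
def liftFun (F : FundamentalGroupoid X ⥤ Type u) {a b : X} (γ : Path a b) (y : F.obj ⟨a⟩)
    (t : unitInterval) : CoverSpace F :=
  ⟨γ t, F.map (pathHom ((γ.subpath 0 t).cast γ.source.symm rfl)) y⟩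

theorem pathHom_subpath_cast {a b : X} (γ : Path a b) (s t : unitInterval) :
    pathHom ((γ.subpath 0 s).cast γ.source.symm rfl) ≫ pathHom (γ.subpath s t) =
      pathHom ((γ.subpath 0 t).cast γ.source.symm rfl) :=
  pathHom_eq ⟨Path.Homotopy.subpathTransSubpath γ 0 s t⟩

theorem map_pathHom_cast {a b b' : X} (h : b' = b) (γ : Path a b) (y : F.obj ⟨a⟩) :
    (⟨b', F.map (pathHom (γ.cast rfl h)) y⟩ : CoverSpace F) = ⟨b, F.map (pathHom γ) y⟩ := by
  subst h
  rfl

theorem liftFun_zero {a b : X} (γ : Path a b) (y : F.obj ⟨a⟩) : liftFun F γ y 0 = ⟨a, y⟩ := by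
  have h : (γ.subpath 0 0).cast γ.source.symm rfl = (Path.refl a).cast rfl γ.source := by
    ext t
    simp
  rw [liftFun, h, map_pathHom_cast, pathHom_refl, Functor.map_id_apply]

theorem liftFun_one {a b : X} (γ : Path a b) (y : F.obj ⟨a⟩) :
    liftFun F γ y 1 = ⟨b, F.map (pathHom γ) y⟩ := by
  have h : (γ.subpath 0 1).cast γ.source.symm rfl = γ.cast rfl γ.target := by
    ext t
    simp
  rw [liftFun, h, map_pathHom_cast]

/-- For `s` close to `t` the segment of `γ` between them stays in `U`, and `F` along it carries the
value at `t` to the value at `s`, so the lift remains in the same sheet. -/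
theorem continuous_liftFun {a b : X} (γ : Path a b) (y : F.obj ⟨a⟩) :
    Continuous (liftFun F γ y) := by
  refine continuous_generateFrom_iff.2 ?_
  rintro _ ⟨U, x, z, hU, rfl⟩
  refine isOpen_iff_mem_nhds.2 fun t ht => ?_
  have hV : γ ⁻¹' U ∈ nhds t := γ.continuous.continuousAt.preimage_mem_nhds
    (hU.isOpen.mem_nhds (pt_mem_of_mem_sheet ht))
  obtain ⟨ε, hε, hball⟩ := Metric.mem_nhds_iff.1 hV
  refine Filter.mem_of_superset (Metric.ball_mem_nhds t hε) fun s hs => ?_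
  have hsub : ∀ r, γ.subpath t s r ∈ U := by
    intro r
    obtain ⟨v, hv, hvr⟩ : γ.subpath t s r ∈ γ '' Set.uIcc t s :=
      γ.range_subpath t s ▸ Set.mem_range_self r
    rw [← hvr]
    refine hball (lt_of_le_of_lt ?_ (Metric.mem_ball.1 hs))
    have hv' : (v : ℝ) ∈ Set.uIcc (t : ℝ) s := by
      rcases Set.mem_uIcc.1 hv with h | h
      exacts [Set.mem_uIcc.2 (.inl h), Set.mem_uIcc.2 (.inr h)]
    exact Set.abs_sub_left_of_mem_uIcc hv'
  have hmem : liftFun F γ y s ∈ sheet F U (liftFun F γ y t).val :=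
    ⟨γ.subpath t s, hsub, by
      change F.map (pathHom (γ.subpath t s)) (F.map _ y) = F.map _ y
      rw [← Functor.map_comp_apply, pathHom_subpath_cast]⟩
  exact sheet_subset ht subset_rfl hmem

theorem monodromy_pt (hF : IsCoveringMap (pt : CoverSpace F → X))
    {a b : X} (γ : Path a b) (y : F.obj ⟨a⟩) :
    hF.monodromy (Path.Homotopic.Quotient.mk γ) ⟨⟨a, y⟩, rfl⟩ =
      ⟨⟨b, F.map (pathHom γ) y⟩, rfl⟩ := by
  let Γ : Path (⟨a, y⟩ : CoverSpace F) ⟨b, F.map (pathHom γ) y⟩ :=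
    { toFun := liftFun F γ y
      continuous_toFun := continuous_liftFun γ y
      source' := liftFun_zero γ y
      target' := liftFun_one γ y }
  -- `Γ` projects to `γ`, so its end point computes the monodromy.
  exact hF.monodromy_map (Path.Homotopic.Quotient.mk Γ)

end CoverSpace

/-- Local inverses carry path connected neighborhoods upstairs. This provides short paths in the
total space of a covering. -/
theorem IsLocalHomeomorph.locallyPathConnectedSpace {Y X : Type*} [TopologicalSpace Y]
    [TopologicalSpace X] [LocallyPathConnectedSpace X] {p : Y → X} (hp : IsLocalHomeomorph p) :
    LocallyPathConnectedSpace Y := by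
  refine .of_bases (p := fun y (s : Set Y) => s ∈ nhds y ∧ IsPathConnected s) (s := fun _ s => s)
    (fun y => Filter.hasBasis_self.2 fun N hN => ?_) fun _ _ h => h.2
  obtain ⟨e, he, rfl⟩ := hp y
  have hN' : e.symm ⁻¹' N ∩ e.target ∈ nhds (e y) := by
    refine Filter.inter_mem ?_ (e.open_target.mem_nhds (e.map_source he))
    refine (e.continuousAt_symm (e.map_source he)).preimage_mem_nhds ?_
    rwa [e.left_inv he]
  obtain ⟨V, ⟨hV, hVc⟩, hVN⟩ := (path_connected_basis (e y)).mem_iff.1 hN'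
  refine ⟨e.symm '' V, ?_, hVc.image' (e.continuousOn_symm.mono fun z hz => (hVN hz).2), ?_⟩
  · have := e.symm.image_mem_nhds (e.map_source he) hV
    rwa [e.left_inv he] at this
  · rintro _ ⟨z, hz, rfl⟩
    exact (hVN hz).1

/-! ### Unit and counit of the equivalence -/

namespace Cov

variable {X : Type u} [TopologicalSpace X]

/-- The canonical map `Y → Y(F(p))`, `y ↦ (p(y), y)`. -/
def unit (C : Cov X) (y : C.total) : CoverSpace ((monodromyFunctor X).obj C) :=
  ⟨C.proj y, ⟨y, rfl⟩⟩

theorem unit_bijective (C : Cov X) : Function.Bijective C.unit := by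
  refine ⟨fun y z h => ?_, fun ⟨x, ⟨y, (hy : C.proj y = x)⟩⟩ => ?_⟩
  · have key : ∀ w w' : CoverSpace ((monodromyFunctor X).obj C), w = w' →
        (show C.total from (show C.proj ⁻¹' {w.pt} from w.val).1) =
          (show C.proj ⁻¹' {w'.pt} from w'.val).1 := by
      rintro w _ rfl
      rfl
    exact key _ _ h
  · subst hy
    exact ⟨y, rfl⟩

/-- A point `z'` near `z` is joined to `z` by a path over `U`. This path lifts its own projection,
so monodromy takes `z` to `z'` and both lie in one sheet. -/
theorem continuous_unit [LocallyPathConnectedSpace X] (C : Cov X) : Continuous C.unit := by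
  have := C.isCov.isLocalHomeomorph.locallyPathConnectedSpace
  refine continuous_generateFrom_iff.2 ?_
  rintro _ ⟨U, x, e, hU, rfl⟩
  refine isOpen_iff_mem_nhds.2 fun z hz => ?_
  have hzU : z ∈ C.proj ⁻¹' U := CoverSpace.pt_mem_of_mem_sheet hz
  refine Filter.mem_of_superset (pathComponentIn_mem_nhds
    ((hU.isOpen.preimage C.isCov.continuous).mem_nhds hzU)) ?_
  rintro z' ⟨δ, hδ⟩
  exact CoverSpace.sheet_subset hz subset_rfl ⟨δ.map C.isCov.continuous, hδ,
    C.isCov.monodromy_map (Path.Homotopic.Quotient.mk δ)⟩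

theorem Hom.ext {C D : Cov X} : ∀ {f g : Hom C D}, f.toFun = g.toFun → f = g
  | ⟨_, _, _⟩, ⟨_, _, _⟩, rfl => rfl

/-- An isomorphism of covering spaces from a homeomorphism over `X`. -/
def isoOfHomeomorph {C D : Cov X} (e : C.total ≃ₜ D.total) (he : ∀ y, D.proj (e y) = C.proj y) :
    C ≅ D where
  hom := (⟨e, e.continuous, he⟩ : Hom C D)
  inv := (⟨e.symm, e.symm.continuous, fun y => by rw [← he, e.apply_symm_apply]⟩ : Hom D C)
  hom_inv_id := Hom.ext e.symm_comp_self
  inv_hom_id := Hom.ext e.self_comp_symm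

section

variable (h : ∀ F : FundamentalGroupoid X ⥤ Type u, IsCoveringMap (CoverSpace.pt : CoverSpace F → X))

theorem isLocalHomeomorph_unit [LocallyPathConnectedSpace X]
    (h : ∀ F : FundamentalGroupoid X ⥤ Type u, IsCoveringMap (CoverSpace.pt : CoverSpace F → X))
    (C : Cov X) : IsLocalHomeomorph C.unit :=
  .of_comp (g := CoverSpace.pt) C.isCov.isLocalHomeomorph (h _).isLocalHomeomorph C.continuous_unit

/-- The canonical isomorphisms `Y ≅ Y(F(p))` are natural in `p`. -/
noncomputable def unitIso [LocallyPathConnectedSpace X] : 𝟭 (Cov X) ≅ monodromyFunctor X ⋙ CoverSpace.functor h :=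
  NatIso.ofComponents (fun C => isoOfHomeomorph (D := (CoverSpace.functor h).obj _)
      ((isLocalHomeomorph_unit h C).toHomeomorphOfBijective C.unit_bijective) fun _ => rfl)
    fun {C D} f => Hom.ext <| by
      funext y
      change D.unit (f.toFun y) = CoverSpace.map ((monodromyFunctor X).map f) (C.unit y)
      -- The two sides have base points `D.proj (f.toFun y)` and `C.proj y`; generalizing the base
      -- point avoids a transport.
      have key : ∀ (x : X) (hf : D.proj (f.toFun y) = x),
          D.unit (f.toFun y) = ⟨x, ⟨f.toFun y, hf⟩⟩ := by
        rintro _ rfl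
        rfl
      exact key _ _

/-- The bijection `F(p(F))(x) = {x} × F(x) → F(x)`. -/
noncomputable def counitEquiv (F : FundamentalGroupoid X ⥤ Type u) (x : X) :
    (CoverSpace.pt : CoverSpace F → X) ⁻¹' {x} ≃ F.obj ⟨x⟩ where
  -- The point lies over some `z` with `z = x` only propositionally, so its value is moved to `F(x)`
  -- by an identity morphism.
  toFun w := F.map (eqToHom (congrArg FundamentalGroupoid.mk w.2)) w.1.val
  invFun a := ⟨⟨x, a⟩, rfl⟩
  left_inv := by
    rintro ⟨⟨z, a⟩, (rfl : z = x)⟩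
    simp
  right_inv a := by simp

theorem counitEquiv_apply (F : FundamentalGroupoid X ⥤ Type u) (x : X) (a : F.obj ⟨x⟩) :
    counitEquiv F x ⟨⟨x, a⟩, rfl⟩ = a := (counitEquiv F x).apply_symm_apply a

/-- The canonical isomorphisms `F(p(F)) ≅ F` are natural in `F`. -/
noncomputable def counitIso : CoverSpace.functor h ⋙ monodromyFunctor X ≅
    𝟭 (FundamentalGroupoid X ⥤ Type u) :=
  NatIso.ofComponents
    (fun F => NatIso.ofComponents (fun x => (counitEquiv F x.as).toIso) (by
      rintro ⟨x⟩ ⟨z⟩ ⟨γ⟩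
      ext ⟨⟨x', a⟩, (hx : x' = x)⟩
      subst hx
      refine (congrArg (counitEquiv F z) (CoverSpace.monodromy_pt (h F) γ a)).trans ?_
      refine (counitEquiv_apply F z _).trans ?_
      exact congrArg (F.map (CoverSpace.pathHom γ)) (counitEquiv_apply F x' a).symm))
    (by
      intro F G τ
      ext ⟨x⟩ ⟨⟨x', a⟩, (hx : x' = x)⟩
      subst hx
      refine (counitEquiv_apply G x' _).trans ?_
      exact congrArg (τ.app ⟨x'⟩) (counitEquiv_apply F x' a).symm)

theorem isEquivalence_monodromyFunctor [LocallyPathConnectedSpace X]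
    (h : ∀ F : FundamentalGroupoid X ⥤ Type u, IsCoveringMap (CoverSpace.pt : CoverSpace F → X)) :
    (monodromyFunctor X).IsEquivalence :=
  (CategoryTheory.Equivalence.mk (monodromyFunctor X) (CoverSpace.functor h) (unitIso h)
    (counitIso h)).isEquivalence_functor

theorem isEquivalence_coverSpaceFunctor [LocallyPathConnectedSpace X] : (CoverSpace.functor h).IsEquivalence :=
  (CategoryTheory.Equivalence.mk (monodromyFunctor X) (CoverSpace.functor h) (unitIso h)
    (counitIso h)).isEquivalence_inverse

end

/-- Monodromy along a path from `x₀` carries a point over `x₀` into any other fibre. -/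
theorem surjective_proj_iff [PathConnectedSpace X] (C : Cov X) (x₀ : X) :
    Function.Surjective C.proj ↔ Nonempty (C.proj ⁻¹' {x₀}) := by
  refine ⟨fun hC => ?_, fun ⟨e⟩ x => ?_⟩
  · obtain ⟨y, hy⟩ := hC x₀
    exact ⟨⟨y, hy⟩⟩
  · let e' := C.isCov.monodromy (.mk (PathConnectedSpace.somePath x₀ x)) e
    exact ⟨e'.1, e'.2⟩

end Cov

/-! ### From the fundamental groupoid to the fundamental group -/

namespace RightPiOneSet

variable {X : Type u} [TopologicalSpace X] {x₀ : X}

theorem Hom.ext {S T : RightPiOneSet X x₀} : ∀ {f g : Hom S T}, f.toFun = g.toFun → f = g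
  | ⟨_, _⟩, ⟨_, _⟩, rfl => rfl

/-- An isomorphism of right sets from an equivariant bijection. -/
def isoOfEquiv {S T : RightPiOneSet X x₀} (e : S.carrier ≃ T.carrier)
    (he : ∀ s a, e (S.act s a) = T.act (e s) a) : S ≅ T where
  hom := (⟨e, he⟩ : Hom S T)
  inv := (⟨e.symm, fun t a => by rw [e.symm_apply_eq, he, e.apply_symm_apply]⟩ : Hom T S)
  hom_inv_id := Hom.ext e.symm_comp_self
  inv_hom_id := Hom.ext e.self_comp_symm

variable (X x₀) in
/-- The functor evaluating a functor on the fundamental groupoid at `x₀`. -/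
def ofFunctor : (FundamentalGroupoid X ⥤ Type u) ⥤ RightPiOneSet X x₀ where
  obj F :=
    { carrier := F.obj ⟨x₀⟩
      act := fun s a => F.map (FundamentalGroupoid.fromPath a) s
      act_one := fun s => Functor.map_id_apply F ⟨x₀⟩ s
      act_mul := fun s a b => Functor.map_comp_apply F
        (FundamentalGroupoid.fromPath a) (FundamentalGroupoid.fromPath b) s }
  map τ :=
    { toFun := fun s => τ.app ⟨x₀⟩ s
      map_act := fun s a => NatTrans.naturality_apply τ (FundamentalGroupoid.fromPath a) s }
  map_id _ := rfl
  map_comp _ _ := rfl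

theorem map_map_inv_apply {F : FundamentalGroupoid X ⥤ Type u} {x y : FundamentalGroupoid X}
    (g : x ⟶ y) (a : F.obj y) : F.map g (F.map (Groupoid.inv g) a) = a := by
  rw [← Functor.map_comp_apply, Groupoid.inv_comp, Functor.map_id_apply]

section

variable [PathConnectedSpace X]

/-- A chosen morphism of the fundamental groupoid from the base point. -/
noncomputable def basePath (x₀ : X) (x : FundamentalGroupoid X) :
    FundamentalGroupoid.mk x₀ ⟶ x :=
  FundamentalGroupoid.fromPath (.mk (PathConnectedSpace.somePath x₀ x.as))

instance faithful_ofFunctor : (ofFunctor X x₀).Faithful where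
  map_injective {F G} τ σ h := by
    have h₀ : ∀ s : F.obj ⟨x₀⟩, τ.app ⟨x₀⟩ s = σ.app ⟨x₀⟩ s :=
      fun s => congrFun (congrArg Hom.toFun h) s
    ext x a
    obtain ⟨s, rfl⟩ : ∃ s, F.map (basePath x₀ x) s = a :=
      ⟨_, map_map_inv_apply (basePath x₀ x) a⟩
    exact (NatTrans.naturality_apply τ _ s).trans
      ((congrArg (G.map (basePath x₀ x)) (h₀ s)).trans (NatTrans.naturality_apply σ _ s).symm)

instance full_ofFunctor : (ofFunctor X x₀).Full where
  map_surjective {F G} f := by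
    have hf : ∀ (s : F.obj ⟨x₀⟩) (g : FundamentalGroupoid.mk x₀ ⟶ FundamentalGroupoid.mk x₀),
        f.toFun (F.map g s) = G.map g (f.toFun s) := fun s g => f.map_act s g
    -- Naturality along the chosen paths forces this formula.
    let τ : F ⟶ G :=
      { app := fun x => TypeCat.ofHom fun a =>
          (G.map (basePath x₀ x) (f.toFun (F.map (Groupoid.inv (basePath x₀ x)) a)) : G.obj x)
        naturality := fun x z g => by
          ext a
          change G.map (basePath x₀ z) (f.toFun (F.map (Groupoid.inv (basePath x₀ z))
            (F.map g a))) = G.map g (G.map (basePath x₀ x)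
              (f.toFun (F.map (Groupoid.inv (basePath x₀ x)) a)))
          obtain ⟨s, rfl⟩ : ∃ s, F.map (basePath x₀ x) s = a :=
            ⟨_, map_map_inv_apply (basePath x₀ x) a⟩
          simp only [← Functor.map_comp_apply]
          rw [hf, hf]
          have key : ∀ t : G.obj ⟨x₀⟩, G.map (basePath x₀ z)
              (G.map ((basePath x₀ x ≫ g) ≫ Groupoid.inv (basePath x₀ z)) t) =
                G.map g (G.map (basePath x₀ x)
                  (G.map (basePath x₀ x ≫ Groupoid.inv (basePath x₀ x)) t)) := by
            intro t
            simp only [← Functor.map_comp_apply]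
            refine congrArg (fun k => G.map k t) ?_
            simp
          exact key _ }
    refine ⟨τ, Hom.ext ?_⟩
    funext s
    change G.map (basePath x₀ ⟨x₀⟩) (f.toFun (F.map (Groupoid.inv (basePath x₀ ⟨x₀⟩)) s)) =
      f.toFun s
    -- The chosen path from `x₀` to itself may be a nontrivial loop; equivariance of `f` cancels it.
    refine (congrArg (G.map (basePath x₀ ⟨x₀⟩)) (hf s _)).trans ?_
    exact map_map_inv_apply _ (f.toFun s)

/-- The functor with constant value the underlying set of a right set, on which paths act through
the chosen paths from the base point. -/
noncomputable def toFunctor (S : RightPiOneSet X x₀) : FundamentalGroupoid X ⥤ Type u where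
  obj _ := S.carrier
  map {x z} g := TypeCat.ofHom fun s =>
    S.act s (basePath x₀ x ≫ g ≫ Groupoid.inv (basePath x₀ z) :)
  map_id x := by
    ext s
    change S.act s (basePath x₀ x ≫ 𝟙 _ ≫ Groupoid.inv (basePath x₀ x)) = s
    rw [Category.id_comp, Groupoid.comp_inv]
    exact S.act_one s
  map_comp {x y z} g g' := by
    ext s
    refine Eq.trans ?_ (S.act_mul s _ _)
    refine congrArg (S.act s) ?_
    change basePath x₀ x ≫ (g ≫ g') ≫ Groupoid.inv (basePath x₀ z) =
      (basePath x₀ x ≫ g ≫ Groupoid.inv (basePath x₀ y)) ≫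
        (basePath x₀ y ≫ g' ≫ Groupoid.inv (basePath x₀ z))
    simp

/-- Every right set is the value at the base point of a functor on the fundamental groupoid. -/
noncomputable def ofFunctorToFunctorIso (S : RightPiOneSet X x₀) :
    (ofFunctor X x₀).obj S.toFunctor ≅ S :=
  isoOfEquiv
    -- The identity need not be equivariant, since `toFunctor` conjugates by the chosen loop at
    -- `x₀`; acting by that loop corrects this.
    { toFun := fun s => S.act s (basePath x₀ ⟨x₀⟩ :)
      invFun := fun s => S.act s (Groupoid.inv (basePath x₀ ⟨x₀⟩) :)
      left_inv := fun s => by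
        refine (S.act_mul s _ _).symm.trans ((congrArg (S.act s) ?_).trans (S.act_one s))
        exact Groupoid.comp_inv (basePath x₀ ⟨x₀⟩)
      right_inv := fun s => by
        refine (S.act_mul s _ _).symm.trans ((congrArg (S.act s) ?_).trans (S.act_one s))
        exact Groupoid.inv_comp (basePath x₀ ⟨x₀⟩) }
    fun s a => by
      refine (S.act_mul s _ _).symm.trans ((congrArg (S.act s) ?_).trans (S.act_mul s _ _))
      change (basePath x₀ ⟨x₀⟩ ≫ FundamentalGroupoid.fromPath a ≫
        Groupoid.inv (basePath x₀ ⟨x₀⟩)) ≫ basePath x₀ ⟨x₀⟩ =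
          basePath x₀ ⟨x₀⟩ ≫ FundamentalGroupoid.fromPath a
      simp

instance essSurj_ofFunctor : (ofFunctor X x₀).EssSurj where
  mem_essImage S := ⟨S.toFunctor, ⟨S.ofFunctorToFunctorIso⟩⟩

instance isEquivalence_ofFunctor : (ofFunctor X x₀).IsEquivalence where

end

end RightPiOneSet

/-- The fibre functor is definitionally the monodromy functor followed by evaluation at `x₀`. -/
theorem Cov.isEquivalence_fibreFunctor {X : Type u} [TopologicalSpace X] [PathConnectedSpace X]
    (h : (Cov.monodromyFunctor X).IsEquivalence) (x₀ : X) :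
    (Cov.fibreFunctor X x₀).IsEquivalence :=
  inferInstanceAs (Cov.monodromyFunctor X ⋙ RightPiOneSet.ofFunctor X x₀).IsEquivalence

theorem mainTheorem1 (X : Type u) [TopologicalSpace X] [PathConnectedSpace X]
    [LocallyPathConnectedSpace X] (hX : SemilocallySimplyConnected X) :
    -- the classification of covering maps
    (∃ hcov : ∀ F : FundamentalGroupoid X ⥤ Type u,
        IsCoveringMap (CoverSpace.pt : CoverSpace F → X),
      (Cov.monodromyFunctor X).IsEquivalence ∧
      (CoverSpace.functor hcov).IsEquivalence ∧
      (∃ η : 𝟭 (Cov X) ≅ Cov.monodromyFunctor X ⋙ CoverSpace.functor hcov,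
        ∀ (C : Cov X) (y : C.total), (η.hom.app C).toFun y = ⟨C.proj y, ⟨y, rfl⟩⟩) ∧
      (∃ ε : CoverSpace.functor hcov ⋙ Cov.monodromyFunctor X ≅
          𝟭 (FundamentalGroupoid X ⥤ Type u),
        ∀ (F : FundamentalGroupoid X ⥤ Type u) (x : X) (a : F.obj ⟨x⟩),
          ((ε.hom.app F).app ⟨x⟩ : (CoverSpace.pt : CoverSpace F → X) ⁻¹' {x} → F.obj ⟨x⟩)
            ⟨⟨x, a⟩, rfl⟩ = a)) ∧
    -- surjective covering maps correspond to functors with non-empty values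
    (∀ C : Cov X, Function.Surjective C.proj ↔
      ∀ x, Nonempty (((Cov.monodromyFunctor X).obj C).obj x)) ∧
    (∀ F : FundamentalGroupoid X ⥤ Type u,
      Function.Surjective (CoverSpace.pt : CoverSpace F → X) ↔ ∀ x, Nonempty (F.obj x)) ∧
    -- the equivalence with right sets over the fundamental group
    (∀ x₀ : X, (Cov.fibreFunctor X x₀).IsEquivalence ∧
      ∀ C : Cov X, Function.Surjective C.proj ↔
        Nonempty ((Cov.fibreFunctor X x₀).obj C).carrier) := by
  have hcov := CoverSpace.isCoveringMap_pt hX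
  have heq := Cov.isEquivalence_monodromyFunctor hcov
  refine ⟨⟨hcov, heq, Cov.isEquivalence_coverSpaceFunctor hcov,
    ⟨Cov.unitIso hcov, fun _ _ => rfl⟩,
    ⟨Cov.counitIso hcov, fun F x a => Cov.counitEquiv_apply F x a⟩⟩,
    fun C => ⟨fun hC x => ?_, fun hC x => ?_⟩, fun F => ⟨fun hF x => ?_, fun hF x => ?_⟩,
    fun x₀ => ⟨Cov.isEquivalence_fibreFunctor heq x₀, fun C => C.surjective_proj_iff x₀⟩⟩
  · exact (C.surjective_proj_iff x.as).1 hC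
  · exact (C.surjective_proj_iff x).2 (hC ⟨x⟩) x
  · obtain ⟨⟨_, a⟩, rfl⟩ := hF x.as
    exact ⟨a⟩
  · exact ⟨⟨x, (hF ⟨x⟩).some⟩, rfl⟩
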